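/- Let $q:[0,1]\to[0,1]$ be Minkowski's question mark function: $q(1)=1$, and for $x=[0;a_1,a_2,\dots]\in[0,1)$ (regular continued fraction, finite if $x$ is rational) $q(x)=2\sum_{i\ge1}(-1)^{i+1}2^{-(a_1+\dots+a_i)}$, the sum running over the existing partial quotients. Let $f(x)=\int_0^1 e^{ixt}\,dq(t)$, $x\in\mathbb{R}$, be its Fourier–Stieltjes transform, and let $J_0$ be the Bessel function of the first kind of order zero. Then for every real $x>0$, $f$ is differentiable at $x$, the integral below converges as an improper integral $\lim_{Y\to\infty}\int_0^Y$ (possibly only conditionally), and $$\frac{e^{ix}}{2-e^{ix}}\left[f'(x)+\frac{2i\,f(x)}{2-e^{ix}}\right]=-\int_0^\infty J_0\!\left(2\sqrt{xy}\right)e^{-iy}f(y)\,dy .$$ -/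

import Mathlib

open Filter Topology MeasureTheory

noncomputable section

namespace Minkowski

/-- The `j`-th partial quotient `a_{j+1}` of the regular continued fraction
`x = [a₀; a₁, a₂, …]` (and `0` once the expansion has stopped). -/
def cfDigit (x : ℝ) (j : ℕ) : ℝ := ((GenContFract.of x).partDens.get? j).getD 0

/-- The term `(-1)^i 2^{-(a₁ + ⋯ + a_{i+1})}`; it is `0` if the expansion has no
partial quotient `a_{i+1}`. -/
def qTerm (x : ℝ) (i : ℕ) : ℝ :=
  if (GenContFract.of x).TerminatedAt i then 0
  else (-1) ^ i * (2 : ℝ) ^ (-∑ j ∈ Finset.range (i + 1), cfDigit x j)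

/-- Minkowski's question mark function
`?([a₀; a₁, a₂, …]) = a₀ + 2 ∑_{i ≥ 1} (-1)^{i+1} 2^{-(a₁ + ⋯ + a_i)}`, where `a₀ = ⌊x⌋`.
On `[0, 1)` one has `a₀ = 0`, and `?(1) = 1`. -/
def questionMark (x : ℝ) : ℝ := (GenContFract.of x).h + 2 * ∑' i, qTerm x i

theorem qTerm_of_fract_eq_zero {x : ℝ} (h : Int.fract x = 0) (i : ℕ) : qTerm x i = 0 := by
  obtain ⟨a, rfl⟩ : ∃ a : ℤ, x = a := ⟨⌊x⌋, eq_of_sub_eq_zero h⟩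
  unfold qTerm
  rw [if_pos]
  rw [GenContFract.terminatedAt_iff_s_none, GenContFract.of_s_of_int]
  exact Stream'.Seq.get?_nil i

theorem cfDigit_zero {x : ℝ} (h : Int.fract x ≠ 0) :
    cfDigit x 0 = (⌊(Int.fract x)⁻¹⌋ : ℝ) := by
  have h1 : (GenContFract.of x).s.get? 0 = some ⟨1, ⌊(Int.fract x)⁻¹⌋⟩ :=
    GenContFract.of_s_head h
  rw [cfDigit, GenContFract.partDen_eq_s_b h1, Option.getD_some]

theorem cfDigit_succ (x : ℝ) (j : ℕ) : cfDigit x (j + 1) = cfDigit (Int.fract x)⁻¹ j := by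
  simp only [cfDigit, GenContFract.partDens, Stream'.Seq.map_get?, GenContFract.of_s_succ]

theorem qTerm_zero {x : ℝ} (h : Int.fract x ≠ 0) :
    qTerm x 0 = (2 : ℝ) ^ (-(⌊(Int.fract x)⁻¹⌋ : ℝ)) := by
  have h1 : (GenContFract.of x).s.get? 0 = some ⟨1, ⌊(Int.fract x)⁻¹⌋⟩ :=
    GenContFract.of_s_head h
  unfold qTerm
  rw [if_neg]
  · simp [cfDigit_zero h]
  · rw [GenContFract.terminatedAt_iff_s_none, h1]
    simp

theorem qTerm_succ {x : ℝ} (h : Int.fract x ≠ 0) (i : ℕ) :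
    qTerm x (i + 1) = -((2 : ℝ) ^ (-(⌊(Int.fract x)⁻¹⌋ : ℝ)) * qTerm (Int.fract x)⁻¹ i) := by
  unfold qTerm
  have h1 : (GenContFract.of x).TerminatedAt (i + 1) ↔
      (GenContFract.of (Int.fract x)⁻¹).TerminatedAt i := by
    rw [GenContFract.terminatedAt_iff_s_none, GenContFract.terminatedAt_iff_s_none,
      GenContFract.of_s_succ]
  by_cases h2 : (GenContFract.of (Int.fract x)⁻¹).TerminatedAt i
  · rw [if_pos (h1.2 h2), if_pos h2]
    simp
  · rw [if_neg (fun h3 => h2 (h1.1 h3)), if_neg h2, Finset.sum_range_succ', cfDigit_zero h]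
    simp only [cfDigit_succ]
    rw [neg_add, Real.rpow_add (by norm_num)]
    ring

theorem one_le_floor_inv_fract {x : ℝ} (h : Int.fract x ≠ 0) : 1 ≤ ⌊(Int.fract x)⁻¹⌋ := by
  have h0 : 0 < Int.fract x := lt_of_le_of_ne (Int.fract_nonneg x) (Ne.symm h)
  rw [Int.le_floor]
  exact_mod_cast (one_le_inv₀ h0).2 (Int.fract_lt_one x).le

theorem two_rpow_neg_le {n : ℤ} (hn : 1 ≤ n) : (2 : ℝ) ^ (-(n : ℝ)) ≤ 1 / 2 := by
  calc (2 : ℝ) ^ (-(n : ℝ)) ≤ (2 : ℝ) ^ (-1 : ℝ) := by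
        apply Real.rpow_le_rpow_of_exponent_le (by norm_num)
        have : (1 : ℝ) ≤ n := by exact_mod_cast hn
        linarith
    _ = 1 / 2 := by rw [Real.rpow_neg_one]; norm_num

theorem abs_qTerm_le (i : ℕ) (x : ℝ) : |qTerm x i| ≤ (1 / 2) ^ (i + 1) := by
  induction i generalizing x with
  | zero =>
    by_cases h : Int.fract x = 0
    · rw [qTerm_of_fract_eq_zero h]; simp
    · rw [qTerm_zero h, abs_of_nonneg (by positivity)]
      simpa using two_rpow_neg_le (one_le_floor_inv_fract h)
  | succ i ih =>
    by_cases h : Int.fract x = 0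
    · rw [qTerm_of_fract_eq_zero h]; simp only [abs_zero]; positivity
    · rw [qTerm_succ h, abs_neg, abs_mul, pow_succ' _ (i + 1)]
      refine mul_le_mul ?_ (ih _) (abs_nonneg _) (by norm_num)
      rw [abs_of_nonneg (by positivity)]
      exact two_rpow_neg_le (one_le_floor_inv_fract h)

theorem summable_qTerm (x : ℝ) : Summable (qTerm x) := by
  refine Summable.of_norm_bounded (g := fun i : ℕ => (1 / 2 : ℝ) ^ (i + 1)) ?_
    (fun i => abs_qTerm_le i x)
  exact (summable_nat_add_iff 1).2 (summable_geometric_of_lt_one (by norm_num) (by norm_num))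

/-- The fractional part `?(x) - ⌊x⌋`. -/
def qFrac (x : ℝ) : ℝ := 2 * ∑' i, qTerm x i

theorem questionMark_eq (x : ℝ) : questionMark x = ⌊x⌋ + qFrac x := rfl

theorem qFrac_of_fract_eq_zero {x : ℝ} (h : Int.fract x = 0) : qFrac x = 0 := by
  simp [qFrac, qTerm_of_fract_eq_zero h]

theorem qFrac_eq {x : ℝ} (h : Int.fract x ≠ 0) :
    qFrac x = (2 : ℝ) ^ (-(⌊(Int.fract x)⁻¹⌋ : ℝ)) * (2 - qFrac (Int.fract x)⁻¹) := by
  unfold qFrac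
  rw [(summable_qTerm x).tsum_eq_zero_add, qTerm_zero h]
  simp only [qTerm_succ h]
  rw [tsum_neg, tsum_mul_left]
  ring

theorem abs_qFrac_le (x : ℝ) : |qFrac x| ≤ 2 := by
  have h1 : HasSum (fun i : ℕ => (1 / 2 : ℝ) ^ (i + 1)) 1 := by
    simpa [pow_succ] using hasSum_geometric_two.mul_right (1 / 2 : ℝ)
  have h2 : ‖∑' i, qTerm x i‖ ≤ 1 :=
    tsum_of_norm_bounded h1 (fun i => abs_qTerm_le i x)
  rw [Real.norm_eq_abs] at h2
  rw [qFrac, abs_mul, abs_of_pos (by norm_num : (0 : ℝ) < 2)]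
  linarith

theorem qFrac_nonneg (x : ℝ) : 0 ≤ qFrac x := by
  by_cases h : Int.fract x = 0
  · rw [qFrac_of_fract_eq_zero h]
  · rw [qFrac_eq h]
    have := (abs_le.1 (abs_qFrac_le (Int.fract x)⁻¹)).2
    exact mul_nonneg (by positivity) (by linarith)

theorem qFrac_le_one (x : ℝ) : qFrac x ≤ 1 := by
  by_cases h : Int.fract x = 0
  · rw [qFrac_of_fract_eq_zero h]; norm_num
  · rw [qFrac_eq h]
    have h1 := qFrac_nonneg (Int.fract x)⁻¹
    have h2 := two_rpow_neg_le (one_le_floor_inv_fract h)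
    have h3 : (0 : ℝ) < (2 : ℝ) ^ (-(⌊(Int.fract x)⁻¹⌋ : ℝ)) := by positivity
    nlinarith

/-- Approximate monotonicity, by induction on the number of partial quotients read. -/
theorem qFrac_le_add (n : ℕ) (x y : ℝ) (hxy : Int.fract x < Int.fract y) :
    qFrac x ≤ qFrac y + (1 / 2) ^ n := by
  induction n generalizing x y with
  | zero =>
    have h1 := qFrac_le_one x
    have h2 := qFrac_nonneg y
    simp only [pow_zero]
    linarith
  | succ n ih =>
    have hy0 : 0 < Int.fract y := lt_of_le_of_lt (Int.fract_nonneg x) hxy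
    by_cases hx : Int.fract x = 0
    · rw [qFrac_of_fract_eq_zero hx]
      have := qFrac_nonneg y
      positivity
    have hx0 : 0 < Int.fract x := lt_of_le_of_ne (Int.fract_nonneg x) (Ne.symm hx)
    have hlt : (Int.fract y)⁻¹ < (Int.fract x)⁻¹ := inv_strictAnti₀ hx0 hxy
    rw [qFrac_eq hx, qFrac_eq hy0.ne']
    rcases (Int.floor_mono hlt.le).lt_or_eq with hf | hf
    · have h1 : (2 : ℝ) ^ (-(⌊(Int.fract x)⁻¹⌋ : ℝ))
          ≤ (2 : ℝ) ^ (-(⌊(Int.fract y)⁻¹⌋ : ℝ)) * (1 / 2) := by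
        have h2 : (⌊(Int.fract y)⁻¹⌋ : ℝ) + 1 ≤ ⌊(Int.fract x)⁻¹⌋ := by exact_mod_cast hf
        calc (2 : ℝ) ^ (-(⌊(Int.fract x)⁻¹⌋ : ℝ))
            ≤ (2 : ℝ) ^ (-(⌊(Int.fract y)⁻¹⌋ : ℝ) + (-1)) := by
              apply Real.rpow_le_rpow_of_exponent_le (by norm_num)
              linarith
          _ = (2 : ℝ) ^ (-(⌊(Int.fract y)⁻¹⌋ : ℝ)) * (1 / 2) := by
              rw [Real.rpow_add (by norm_num), Real.rpow_neg_one]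
              norm_num
      have h3 := qFrac_nonneg (Int.fract x)⁻¹
      have h4 := qFrac_le_one (Int.fract y)⁻¹
      have h5 : (0 : ℝ) < (2 : ℝ) ^ (-(⌊(Int.fract x)⁻¹⌋ : ℝ)) := by positivity
      have h6 : (0 : ℝ) < (2 : ℝ) ^ (-(⌊(Int.fract y)⁻¹⌋ : ℝ)) := by positivity
      have h7 : (0 : ℝ) ≤ (1 / 2) ^ (n + 1) := by positivity
      nlinarith
    · have h1 : Int.fract (Int.fract y)⁻¹ < Int.fract (Int.fract x)⁻¹ := by
        simp only [Int.fract] at hlt hf ⊢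
        rw [hf]
        linarith
      have h2 := ih _ _ h1
      rw [← hf]
      have h3 := two_rpow_neg_le (one_le_floor_inv_fract hy0.ne')
      have h4 : (0 : ℝ) < (2 : ℝ) ^ (-(⌊(Int.fract y)⁻¹⌋ : ℝ)) := by positivity
      have h5 : (0 : ℝ) < (1 / 2) ^ n := by positivity
      rw [pow_succ]
      nlinarith

theorem qFrac_le {x y : ℝ} (hxy : Int.fract x < Int.fract y) : qFrac x ≤ qFrac y := by
  have h1 : Tendsto (fun n : ℕ => qFrac y + (1 / 2 : ℝ) ^ n) atTop (𝓝 (qFrac y + 0)) :=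
    tendsto_const_nhds.add (tendsto_pow_atTop_nhds_zero_of_lt_one (by norm_num) (by norm_num))
  rw [add_zero] at h1
  exact ge_of_tendsto' h1 (fun n => qFrac_le_add n x y hxy)

theorem questionMark_mono : Monotone questionMark := by
  intro x y hxy
  rcases hxy.lt_or_eq with hlt | rfl
  · rw [questionMark_eq, questionMark_eq]
    rcases (Int.floor_mono hxy).lt_or_eq with hf | hf
    · have h1 : (⌊x⌋ : ℝ) + 1 ≤ ⌊y⌋ := by exact_mod_cast hf
      have h2 := qFrac_le_one x
      have h3 := qFrac_nonneg y
      linarith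
    · have h1 : Int.fract x < Int.fract y := by
        simp only [Int.fract]
        rw [hf]
        linarith
      rw [hf]
      linarith [qFrac_le h1]
  · exact le_rfl

/-- The Lebesgue–Stieltjes measure `dq` of the question mark function. -/
def dq : Measure ℝ := questionMark_mono.stieltjesFunction.measure

/-- The Fourier–Stieltjes transform `f(x) = ∫₀¹ e^{ixt} dq(t)`. -/
def fourierStieltjes (x : ℝ) : ℂ :=
  ∫ t in Set.Icc (0 : ℝ) 1, Complex.exp (Complex.I * x * t) ∂dq

/-- The Bessel function of the first kind of order zero,
`J₀(z) = ∑ₖ (-1)ᵏ (z/2)²ᵏ / (k!)²`. -/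
def besselJ0 (z : ℝ) : ℝ :=
  ∑' k : ℕ, (-1) ^ k * (z / 2) ^ (2 * k) / ((k.factorial : ℝ) ^ 2)

/-- `∫₀^∞ g(y) dy = L` as a (possibly only conditionally) convergent improper integral. -/
def HasImproperIntegral (g : ℝ → ℂ) (L : ℂ) : Prop :=
  (∀ Y : ℝ, 0 ≤ Y → IntervalIntegrable g volume 0 Y) ∧
    Tendsto (fun Y : ℝ => ∫ y in (0 : ℝ)..Y, g y) atTop (𝓝 L)

end Minkowski

end

/-!
For `0 < t ≤ 1`, the Laplace transform of `y ↦ J₀(2√(xy))` at the boundary point `p = it` is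
`∫₀^∞ J₀(2√(xy)) e^{-ity} dy = e^{ix/t} / (it)`, as a conditionally convergent integral. By the
symmetry `t ↦ 1 - t` of `dq`, `e^{-iy} f(y) = ∫₀¹ e^{-ity} dq(t)`, so exchanging the two
integrations turns the right-hand side of the identity into `-∫₀¹ e^{ix/t} / (it) dq(t)`.
The self-similarity `?(1/(n+s)) = 2^{-n} (2 - ?(s))` says that `dq` is the sum over `n ≥ 1` of
`2^{-n}` times its own image under `s ↦ 1/(n+s)`. Hence, writing `z = e^{ix}`,
`∫₀¹ e^{ix/t} / t dq(t) = ∑ₙ (z/2)ⁿ ∫₀¹ (n+s) e^{ixs} dq(s)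
  = ∑ₙ (z/2)ⁿ (n f(x) - i f'(x))`,
and summing the geometric series gives the left-hand side.

The exchange of the limit `Y → ∞` with `dq` rests on a bound `C/t²` for the truncated integrals over
`[0, Y]`, uniform in `Y`, obtained by integrating by parts twice
(`exists_bound_integral_besselClifford`). The second derivative of `J₀(2√w)` is
`O(w^{-5/4})`, because an energy of the Bessel equation decreases
(`besselClifford_energy_antitone`); so it is absolutely integrable, its Laplace transform is
continuous up to the imaginary axis, and the value at `p = it` follows from the
termwise computation for `Re p > 0` (`tendsto_integral_besselClifford`). Finally `1/t²` is
`dq`-integrable (`integrableOn_inv_sq`) because `dq` gives `(1/(n+1), 1/n]` the mass `2^{-n}`.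
-/

namespace Minkowski

/-! ### Bessel–Clifford functions and their decay -/

/-- The Bessel–Clifford function `∑ₖ (-w)ᵏ / (k! (k+m)!)`, which for `w > 0` equals
`w^{-m/2} J_m(2√w)`. It is entire in `w`, and `J₀(2√w)` is the case `m = 0`. -/
noncomputable def besselClifford (m : ℕ) (w : ℝ) : ℝ :=
  ∑' k : ℕ, (-w) ^ k / ((k.factorial : ℝ) * ((k + m).factorial : ℝ))

theorem norm_besselClifford_term_le (m k : ℕ) (w : ℝ) :
    ‖(-w) ^ k / ((k.factorial : ℝ) * ((k + m).factorial : ℝ))‖ ≤ |w| ^ k / k.factorial := by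
  have h1 : (1 : ℝ) ≤ ((k + m).factorial : ℝ) := by
    exact_mod_cast Nat.succ_le_of_lt (Nat.factorial_pos _)
  have h2 : (0 : ℝ) < (k.factorial : ℝ) := by exact_mod_cast Nat.factorial_pos _
  rw [norm_div, norm_pow, norm_neg, Real.norm_eq_abs, Real.norm_of_nonneg (by positivity)]
  gcongr
  nlinarith

theorem summable_besselClifford (m : ℕ) (w : ℝ) :
    Summable fun k : ℕ => (-w) ^ k / ((k.factorial : ℝ) * ((k + m).factorial : ℝ)) :=
  Summable.of_norm_bounded (Real.summable_pow_div_factorial |w|)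
    fun k => norm_besselClifford_term_le m k w

theorem hasDerivAt_besselClifford (m : ℕ) (w : ℝ) :
    HasDerivAt (besselClifford m) (-besselClifford (m + 1) w) w := by
  have h := hasDerivAt_tsum_of_isPreconnected (𝕜 := ℝ)
    (u := fun k : ℕ => (k : ℝ) * (|w| + 1) ^ (k - 1) / k.factorial)
    (g := fun (k : ℕ) (w : ℝ) => (-w) ^ k / ((k.factorial : ℝ) * ((k + m).factorial : ℝ)))
    (g' := fun (k : ℕ) (w : ℝ) => ((k : ℝ) * (-w) ^ (k - 1) * (-1)) /
      ((k.factorial : ℝ) * ((k + m).factorial : ℝ)))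
    (t := Metric.ball 0 (|w| + 1)) (y₀ := 0) (y := w) ?_ Metric.isOpen_ball
    (convex_ball _ _).isPreconnected ?_ ?_ ?_ ?_ ?_
  · refine h.congr_deriv ?_
    rw [Summable.tsum_eq_zero_add, besselClifford, ← tsum_neg]
    · simp only [Nat.cast_zero, zero_mul, zero_div, zero_add]
      refine tsum_congr fun k => ?_
      have e : k + 1 + m = k + (m + 1) := by ring
      rw [e, Nat.factorial_succ k, add_tsub_cancel_right]
      push_cast
      have h2 : (0 : ℝ) < (k.factorial : ℝ) := by exact_mod_cast Nat.factorial_pos _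
      have h3 : (0 : ℝ) < ((k + (m + 1)).factorial : ℝ) := by exact_mod_cast Nat.factorial_pos _
      field_simp
    · rw [← summable_nat_add_iff 1]
      refine (summable_besselClifford (m + 1) w).neg.congr fun k => ?_
      have e : k + 1 + m = k + (m + 1) := by ring
      rw [e, Nat.factorial_succ k, add_tsub_cancel_right]
      push_cast
      have h2 : (0 : ℝ) < (k.factorial : ℝ) := by exact_mod_cast Nat.factorial_pos _
      have h3 : (0 : ℝ) < ((k + (m + 1)).factorial : ℝ) := by exact_mod_cast Nat.factorial_pos _
      field_simp
  · rw [← summable_nat_add_iff 1]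
    refine (Real.summable_pow_div_factorial (|w| + 1)).congr fun k => ?_
    rw [Nat.factorial_succ k, add_tsub_cancel_right]
    push_cast
    have h2 : (0 : ℝ) < (k.factorial : ℝ) := by exact_mod_cast Nat.factorial_pos _
    field_simp
  · intro k y _
    exact (((hasDerivAt_neg y).fun_pow k)).div_const _
  · intro k y hy
    have hy' : |y| ≤ |w| + 1 := by simpa using (mem_ball_zero_iff.1 hy).le
    have h1 : (1 : ℝ) ≤ ((k + m).factorial : ℝ) := by
      exact_mod_cast Nat.succ_le_of_lt (Nat.factorial_pos _)
    have h2 : (0 : ℝ) < (k.factorial : ℝ) := by exact_mod_cast Nat.factorial_pos _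
    simp only [norm_div, norm_mul, norm_pow, norm_neg, Real.norm_eq_abs, abs_one, mul_one,
      Nat.abs_cast]
    gcongr
    nlinarith
  · simpa using show (0 : ℝ) < |w| + 1 by positivity
  · exact summable_besselClifford m 0
  · rw [mem_ball_zero_iff, Real.norm_eq_abs]; linarith

theorem continuous_besselClifford (m : ℕ) : Continuous (besselClifford m) :=
  continuous_iff_continuousAt.2 fun w => (hasDerivAt_besselClifford m w).continuousAt

/-- With `B₀' = -B₁` and `B₁' = -B₂`, this is the Bessel equation `w B₀'' + B₀' + B₀ = 0`. -/
theorem besselClifford_recurrence (w : ℝ) :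
    w * besselClifford 2 w = besselClifford 1 w - besselClifford 0 w := by
  unfold besselClifford
  rw [← (summable_besselClifford 1 w).tsum_sub (summable_besselClifford 0 w),
    ((summable_besselClifford 1 w).sub (summable_besselClifford 0 w)).tsum_eq_zero_add,
    ← tsum_mul_left]
  simp only [Nat.factorial, pow_zero, Nat.cast_one, zero_add, mul_one, sub_self]
  refine tsum_congr fun k => ?_
  have h2 : (0 : ℝ) < (k.factorial : ℝ) := by exact_mod_cast Nat.factorial_pos _
  push_cast
  field_simp
  ring

theorem besselJ0_two_mul_sqrt {w : ℝ} (hw : 0 ≤ w) :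
    besselJ0 (2 * Real.sqrt w) = besselClifford 0 w := by
  unfold besselJ0 besselClifford
  refine tsum_congr fun k => ?_
  rw [mul_div_cancel_left₀ _ (two_ne_zero), pow_mul, Real.sq_sqrt hw, neg_pow w, add_zero, sq]

/-- In the variable `r = 2√w`, the function `v(r) = √r J₀(r)` satisfies
`v'' + (1 + 1/(4r²)) v = 0`. The quantity here is the energy `v'² + (1 + 1/(4r²)) v²`, which
decreases because the coefficient `1 + 1/(4r²)` does. -/
theorem besselClifford_energy_antitone :
    AntitoneOn (fun w : ℝ =>
      2 * √w * (w * besselClifford 1 w ^ 2 + besselClifford 0 w ^ 2)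
        - √w * (besselClifford 0 w * besselClifford 1 w)
        + besselClifford 0 w ^ 2 / (4 * √w)) (Set.Ici 1) := by
  have energy_deriv : ∀ w : ℝ, 1 ≤ w → HasDerivAt (fun w : ℝ =>
      2 * √w * (w * besselClifford 1 w ^ 2 + besselClifford 0 w ^ 2)
        - √w * (besselClifford 0 w * besselClifford 1 w)
        + besselClifford 0 w ^ 2 / (4 * √w)) (-(besselClifford 0 w ^ 2 / (8 * (w * √w)))) w := by
    intro w hw
    have hs : 0 < √w := Real.sqrt_pos.2 (by linarith)
    have d := Real.hasDerivAt_sqrt (show w ≠ 0 by linarith)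
    have a := hasDerivAt_besselClifford 0 w
    have b := hasDerivAt_besselClifford 1 w
    have e := ((((d.const_mul 2).mul (((hasDerivAt_id w).mul (b.pow 2)).add (a.pow 2))).sub
      (d.mul (a.mul b)))).add ((a.pow 2).div (d.const_mul 4) (by positivity))
    refine e.congr_deriv ?_
    have r := besselClifford_recurrence w
    have r2 : besselClifford 2 w = (besselClifford 1 w - besselClifford 0 w) / (√w * √w) := by
      rw [Real.mul_self_sqrt (by linarith), ← r]; field_simp
    simp only [zero_add, one_add_one_eq_two, Pi.mul_apply, Pi.pow_apply, Pi.add_apply, id]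
    rw [r2]
    have hw2 : w = √w * √w := (Real.mul_self_sqrt (by linarith)).symm
    -- Everything is rational in `s = √w`.
    generalize √w = s at *
    subst hw2
    field_simp
    ring
  refine antitoneOn_of_deriv_nonpos (convex_Ici 1)
    (fun w hw => (energy_deriv w hw).continuousAt.continuousWithinAt) ?_ ?_
  · intro w hw
    rw [interior_Ici] at hw
    exact (energy_deriv w (le_of_lt hw)).differentiableAt.differentiableWithinAt
  · intro w hw
    rw [interior_Ici] at hw
    rw [(energy_deriv w (le_of_lt hw)).deriv]
    have : 0 ≤ w := by linarith [Set.mem_Ioi.1 hw]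
    exact neg_nonpos.2 (by positivity)

/-- The energy bound gives `w^{-1/4}` for `B₀` and `B₁`, and the Bessel equation
`w B₂ = B₁ - B₀` then gains a factor `w⁻¹`, which makes `B₂` integrable. -/
theorem exists_besselClifford_decay : ∃ C : ℝ, 0 ≤ C ∧ ∀ w : ℝ, 1 ≤ w →
    |besselClifford 0 w| ≤ C * w ^ (-(1 / 4) : ℝ) ∧
    |besselClifford 1 w| ≤ C * w ^ (-(1 / 4) : ℝ) ∧
    |besselClifford 2 w| ≤ 2 * C * w ^ (-(5 / 4) : ℝ) := by
  obtain ⟨c, hc⟩ : ∃ c : ℝ, ∀ w : ℝ, 1 ≤ w →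
      2 * √w * (w * besselClifford 1 w ^ 2 + besselClifford 0 w ^ 2)
        - √w * (besselClifford 0 w * besselClifford 1 w)
        + besselClifford 0 w ^ 2 / (4 * √w) ≤ c :=
    ⟨_, fun w hw => besselClifford_energy_antitone Set.self_mem_Ici hw hw⟩
  -- The cross term of the energy is absorbed by the squares once `w ≥ 1`.
  have hsum : ∀ w : ℝ, 1 ≤ w → √w * (besselClifford 1 w ^ 2 + besselClifford 0 w ^ 2) ≤ c := by
    intro w hw
    have hs : 0 < √w := Real.sqrt_pos.2 (by linarith)
    have h1 := hc w hw
    have h2 : 0 ≤ besselClifford 0 w ^ 2 / (4 * √w) := by positivity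
    have h3 : 0 ≤ √w * (2 * (w * besselClifford 1 w ^ 2 + besselClifford 0 w ^ 2)
        - besselClifford 0 w * besselClifford 1 w
        - (besselClifford 1 w ^ 2 + besselClifford 0 w ^ 2)) := by
      refine mul_nonneg hs.le ?_
      nlinarith [sq_nonneg (besselClifford 0 w - besselClifford 1 w),
        mul_nonneg (sub_nonneg.2 hw) (sq_nonneg (besselClifford 1 w)),
        sq_nonneg (besselClifford 0 w), sq_nonneg (besselClifford 1 w)]
    nlinarith
  have hroot : ∀ w v : ℝ, 1 ≤ w → √w * v ^ 2 ≤ c → |v| ≤ √c * w ^ (-(1 / 4) : ℝ) := by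
    intro w v hw h
    have hw0 : 0 < w := by linarith
    have hc0 : 0 ≤ c := le_trans (by positivity) h
    refine abs_le_of_sq_le_sq ?_ (by positivity)
    have e : (w ^ (-(1 / 4) : ℝ)) ^ 2 = (√w)⁻¹ := by
      rw [← Real.rpow_natCast, ← Real.rpow_mul hw0.le, Real.sqrt_eq_rpow, ← Real.rpow_neg hw0.le]
      norm_num
    rw [mul_pow, Real.sq_sqrt hc0, e, ← div_eq_mul_inv, le_div_iff₀ (Real.sqrt_pos.2 hw0)]
    linarith
  refine ⟨√c, Real.sqrt_nonneg _, fun w hw => ?_⟩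
  have hw0 : 0 < w := by linarith
  have hs : 0 < √w := Real.sqrt_pos.2 hw0
  have h0 : |besselClifford 0 w| ≤ √c * w ^ (-(1 / 4) : ℝ) := hroot w _ hw (by
    nlinarith [hsum w hw, mul_nonneg hs.le (sq_nonneg (besselClifford 1 w))])
  have h1 : |besselClifford 1 w| ≤ √c * w ^ (-(1 / 4) : ℝ) := hroot w _ hw (by
    nlinarith [hsum w hw, mul_nonneg hs.le (sq_nonneg (besselClifford 0 w))])
  refine ⟨h0, h1, ?_⟩
  have e : w ^ (-(5 / 4) : ℝ) = w ^ (-(1 / 4) : ℝ) / w := by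
    rw [← Real.rpow_sub_one hw0.ne']; norm_num
  rw [e, ← mul_div_assoc, le_div_iff₀ hw0]
  calc |besselClifford 2 w| * w = |w * besselClifford 2 w| := by
        rw [abs_mul, abs_of_pos hw0, mul_comm]
    _ = |besselClifford 1 w - besselClifford 0 w| := by rw [besselClifford_recurrence]
    _ ≤ _ := by linarith [abs_sub (besselClifford 1 w) (besselClifford 0 w)]

theorem tendsto_besselClifford_zero : Tendsto (besselClifford 0) atTop (𝓝 0) := by
  obtain ⟨C, -, hC⟩ := exists_besselClifford_decay
  have h := (tendsto_rpow_neg_atTop (show (0 : ℝ) < 1 / 4 by norm_num)).const_mul C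
  rw [mul_zero] at h
  exact squeeze_zero_norm' ((eventually_ge_atTop 1).mono fun w hw => (hC w hw).1) h

theorem tendsto_besselClifford_one : Tendsto (besselClifford 1) atTop (𝓝 0) := by
  obtain ⟨C, -, hC⟩ := exists_besselClifford_decay
  have h := (tendsto_rpow_neg_atTop (show (0 : ℝ) < 1 / 4 by norm_num)).const_mul C
  rw [mul_zero] at h
  exact squeeze_zero_norm' ((eventually_ge_atTop 1).mono fun w hw => (hC w hw).2.1) h

theorem integrableOn_besselClifford_two : IntegrableOn (besselClifford 2) (Set.Ioi 0) := by
  obtain ⟨C, -, hC⟩ := exists_besselClifford_decay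
  rw [← Set.Ioc_union_Ioi_eq_Ioi (zero_le_one' ℝ)]
  refine IntegrableOn.union
    ((continuous_besselClifford 2).integrableOn_Icc.mono_set Set.Ioc_subset_Icc_self) ?_
  refine Integrable.mono' ((integrableOn_Ioi_rpow_of_lt (show (-(5 / 4) : ℝ) < -1 by norm_num)
    zero_lt_one).const_mul (2 * C)) (continuous_besselClifford 2).aestronglyMeasurable ?_
  exact (ae_restrict_mem measurableSet_Ioi).mono fun w hw => (hC w (le_of_lt hw)).2.2

theorem integrableOn_besselClifford_two_mul {x : ℝ} (hx : 0 < x) :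
    IntegrableOn (fun y => besselClifford 2 (x * y)) (Set.Ioi 0) := by
  rw [integrableOn_Ioi_comp_mul_left_iff _ _ hx, mul_zero]
  exact integrableOn_besselClifford_two

/-! ### The Laplace transform of `J₀(2√(xy))` up to the imaginary axis -/

theorem norm_exp_neg_mul (p : ℂ) (y : ℝ) :
    ‖Complex.exp (-(p * y))‖ = Real.exp (-(p.re * y)) := by
  rw [Complex.norm_exp]; simp

theorem integrableOn_pow_mul_exp {r : ℝ} (hr : 0 < r) (k : ℕ) :
    IntegrableOn (fun y : ℝ => y ^ k * Real.exp (-(r * y))) (Set.Ioi 0) := by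
  have h := integrableOn_rpow_mul_exp_neg_mul_rpow (p := 1) (s := k) (b := r)
    (by have : (0 : ℝ) ≤ k := k.cast_nonneg; linarith) zero_lt_one hr
  refine h.congr_fun (fun y _ => ?_) measurableSet_Ioi
  simp

theorem integral_pow_mul_exp {r : ℝ} (hr : 0 < r) (k : ℕ) :
    ∫ y in Set.Ioi (0 : ℝ), y ^ k * Real.exp (-(r * y)) = k.factorial / r ^ (k + 1) := by
  have h := Real.integral_rpow_mul_exp_neg_mul_Ioi (a := k + 1) (r := r) (by positivity) hr
  rw [Real.Gamma_nat_eq_factorial] at h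
  simp only [add_sub_cancel_right, Real.rpow_natCast] at h
  rw [h, ← Nat.cast_succ, Real.rpow_natCast, one_div, inv_pow, Nat.succ_eq_add_one]
  field_simp

theorem integrableOn_pow_mul_cexp {p : ℂ} (hp : 0 < p.re) (k : ℕ) :
    IntegrableOn (fun y : ℝ => (y : ℂ) ^ k * Complex.exp (-(p * y))) (Set.Ioi 0) := by
  refine Integrable.mono' (integrableOn_pow_mul_exp hp k)
    (Continuous.aestronglyMeasurable (by fun_prop)) ?_
  refine (ae_restrict_mem measurableSet_Ioi).mono fun y hy => ?_
  rw [norm_mul, norm_pow, norm_exp_neg_mul, Complex.norm_real, Real.norm_of_nonneg (le_of_lt hy)]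

theorem hasDerivAt_cexp_neg_mul (p : ℂ) (y : ℝ) :
    HasDerivAt (fun y : ℝ => Complex.exp (-(p * y))) (-(p * Complex.exp (-(p * y)))) y := by
  have h := (((Complex.ofRealCLM.hasDerivAt (x := y)).const_mul p).neg).cexp
  refine h.congr_deriv ?_
  simp
  ring

theorem integral_pow_mul_cexp {p : ℂ} (hp : 0 < p.re) (k : ℕ) :
    ∫ y in Set.Ioi (0 : ℝ), (y : ℂ) ^ k * Complex.exp (-(p * y)) = k.factorial / p ^ (k + 1) := by
  have hp0 : p ≠ 0 := by rintro rfl; simp at hp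
  have hlim : ∀ k : ℕ, Tendsto (fun y : ℝ => (y : ℂ) ^ k * Complex.exp (-(p * y))) atTop (𝓝 0) := by
    intro k
    rw [tendsto_zero_iff_norm_tendsto_zero]
    refine (tendsto_rpow_mul_exp_neg_mul_atTop_nhds_zero k p.re hp).congr' ?_
    filter_upwards [eventually_ge_atTop 0] with y hy
    rw [norm_mul, norm_pow, norm_exp_neg_mul, Complex.norm_real, Real.norm_of_nonneg hy,
      Real.rpow_natCast, neg_mul]
  induction k with
  | zero =>
    have h := integral_Ioi_of_hasDerivAt_of_tendsto' (fun y _ => hasDerivAt_cexp_neg_mul p y)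
      (by simpa [IntegrableOn] using ((integrableOn_pow_mul_cexp hp 0).const_mul p).neg)
      (by simpa using hlim 0)
    rw [integral_neg, integral_const_mul] at h
    simp only [pow_zero, one_mul, Nat.factorial_zero, Nat.cast_one, zero_add, pow_one]
    simp only [Complex.ofReal_zero, mul_zero, neg_zero, Complex.exp_zero, zero_sub, neg_inj] at h
    rw [eq_div_iff hp0, mul_comm, h]
  | succ k ih =>
    have hd : ∀ y : ℝ, HasDerivAt (fun y : ℝ => (y : ℂ) ^ (k + 1) * Complex.exp (-(p * y)))
        ((k + 1) * ((y : ℂ) ^ k * Complex.exp (-(p * y)))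
          - p * ((y : ℂ) ^ (k + 1) * Complex.exp (-(p * y)))) y := by
      intro y
      have h := ((Complex.ofRealCLM.hasDerivAt (x := y)).fun_pow (k + 1)).mul
        (hasDerivAt_cexp_neg_mul p y)
      refine h.congr_deriv ?_
      simp
      ring
    have i1 := (integrableOn_pow_mul_cexp hp k).const_mul ((k : ℂ) + 1)
    have i2 := (integrableOn_pow_mul_cexp hp (k + 1)).const_mul p
    have h := integral_Ioi_of_hasDerivAt_of_tendsto' (fun y _ => hd y) (i1.sub i2) (hlim (k + 1))
    rw [integral_sub i1 i2, integral_const_mul, integral_const_mul, ih] at h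
    rw [Nat.factorial_succ, pow_succ _ (k + 1), eq_div_iff (by positivity)]
    simp only [Complex.ofReal_zero, ne_eq, Nat.succ_ne_zero, not_false_eq_true, zero_pow, zero_mul,
      sub_zero] at h
    push_cast
    field_simp at h
    linear_combination -h

/-- Termwise integration: `∫ yᵏ e^{-py} dy = k! / p^{k+1}` turns the series of `B₀(xy)` into an
exponential series, absolutely convergent for every `p` with `Re p > 0`. -/
theorem laplace_besselClifford_zero {x : ℝ} (hx : 0 < x) {p : ℂ} (hp : 0 < p.re) :
    ∫ y in Set.Ioi (0 : ℝ), (besselClifford 0 (x * y) : ℂ) * Complex.exp (-(p * y))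
      = Complex.exp (-(x / p)) / p := by
  have hp0 : p ≠ 0 := by rintro rfl; simp at hp
  set F : ℕ → ℝ → ℂ := fun k y =>
    ((-x : ℂ) ^ k / ((k.factorial : ℂ) * k.factorial)) * ((y : ℂ) ^ k * Complex.exp (-(p * y)))
    with hF
  have hnorm : ∀ k, ∀ y ∈ Set.Ioi (0 : ℝ), ‖F k y‖ =
      (x ^ k / ((k.factorial : ℝ) * k.factorial)) * (y ^ k * Real.exp (-(p.re * y))) := by
    intro k y hy
    simp only [hF, norm_mul, norm_div, norm_pow, norm_neg, norm_exp_neg_mul, Complex.norm_real,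
      Complex.norm_natCast, Real.norm_of_nonneg hx.le, Real.norm_of_nonneg (le_of_lt hy)]
  have hint : ∀ k, Integrable (F k) (volume.restrict (Set.Ioi 0)) := by
    intro k
    refine Integrable.mono' ((integrableOn_pow_mul_exp hp k).const_mul
      (x ^ k / ((k.factorial : ℝ) * k.factorial)))
      (Continuous.aestronglyMeasurable (by fun_prop)) ?_
    exact (ae_restrict_mem measurableSet_Ioi).mono fun y hy => (hnorm k y hy).le
  have hsum := hasSum_integral_of_summable_integral_norm hint ?_
  · have hval : ∀ k, ∫ y in Set.Ioi (0 : ℝ), F k y = (-(x / p)) ^ k / k.factorial / p := by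
      intro k
      simp only [hF]
      rw [integral_const_mul, integral_pow_mul_cexp hp]
      have h2 : (k.factorial : ℂ) ≠ 0 := by exact_mod_cast (Nat.factorial_pos _).ne'
      rw [← neg_div, div_pow, pow_succ]
      field_simp
    simp only [hval] at hsum
    have hexp : HasSum (fun k : ℕ => (-(x / p)) ^ k / k.factorial / p)
        (Complex.exp (-(x / p)) / p) := by
      have := NormedSpace.expSeries_div_hasSum_exp (-(x / p) : ℂ)
      rw [← Complex.exp_eq_exp_ℂ] at this
      exact this.div_const p
    rw [← hsum.unique hexp]
    refine integral_congr_ae (Eventually.of_forall fun y => ?_)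
    simp only [hF, besselClifford, Complex.ofReal_tsum]
    rw [← tsum_mul_right]
    refine tsum_congr fun k => ?_
    push_cast
    rw [add_zero, ← neg_mul, mul_pow]
    ring
  · refine ((Real.summable_pow_div_factorial (x / p.re)).div_const p.re).congr fun k => ?_
    rw [setIntegral_congr_fun measurableSet_Ioi (hnorm k), integral_const_mul,
      integral_pow_mul_exp hp]
    have h2 : (k.factorial : ℝ) ≠ 0 := by exact_mod_cast (Nat.factorial_pos _).ne'
    rw [div_pow, pow_succ]
    field_simp

theorem continuous_besselClifford_mul_cexp (m : ℕ) (x : ℝ) (p : ℂ) :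
    Continuous fun y : ℝ => (besselClifford m (x * y) : ℂ) * Complex.exp (-(p * y)) := by
  have := continuous_besselClifford m
  fun_prop

theorem integrableOn_besselClifford_mul_cexp {x : ℝ} (hx : 0 < x) {p : ℂ} (hp : 0 < p.re) :
    IntegrableOn (fun y : ℝ => (besselClifford 0 (x * y) : ℂ) * Complex.exp (-(p * y)))
      (Set.Ioi 0) := by
  have hb : Tendsto (fun y : ℝ => besselClifford 0 (x * y)) atTop (𝓝 0) :=
    tendsto_besselClifford_zero.comp (tendsto_id.const_mul_atTop hx)
  refine (integrable_norm_iff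
    (continuous_besselClifford_mul_cexp 0 x p).aestronglyMeasurable).1 ?_
  refine integrable_of_isBigO_exp_neg hp
    (continuous_besselClifford_mul_cexp 0 x p).norm.continuousOn (Asymptotics.IsBigO.of_bound 1 ?_)
  filter_upwards [hb.norm.eventually (gt_mem_nhds (show ‖(0 : ℝ)‖ < 1 by simp))] with y hy
  rw [norm_norm, norm_mul, norm_exp_neg_mul, Complex.norm_real,
    Real.norm_of_nonneg (Real.exp_pos _).le, neg_mul]
  exact mul_le_mul_of_nonneg_right hy.le (Real.exp_pos _).le

theorem besselClifford_apply_zero (m : ℕ) : besselClifford m 0 = 1 / m.factorial := by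
  rw [besselClifford, tsum_eq_single 0]
  · simp
  · intro k hk; simp [hk]

/-- Two integrations by parts move both derivatives onto `B₀(xy)`, whose second derivative is
`x² B₂(xy)`. -/
theorem integral_besselClifford_by_parts (x : ℝ) {p : ℂ} (hp : p ≠ 0) (Y : ℝ) :
    ∫ y in (0 : ℝ)..Y, (besselClifford 0 (x * y) : ℂ) * Complex.exp (-(p * y)) =
      1 / p - x / p ^ 2
      - ((besselClifford 0 (x * Y) : ℂ) / p - x * (besselClifford 1 (x * Y) : ℂ) / p ^ 2)
          * Complex.exp (-(p * Y))
      + x ^ 2 / p ^ 2 *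
        ∫ y in (0 : ℝ)..Y, (besselClifford 2 (x * y) : ℂ) * Complex.exp (-(p * y)) := by
  have hB : ∀ (m : ℕ) (y : ℝ), HasDerivAt (fun y : ℝ => (besselClifford m (x * y) : ℂ))
      (-(x * besselClifford (m + 1) (x * y) : ℂ)) y := by
    intro m y
    have h := (HasDerivAt.comp y (hasDerivAt_besselClifford m (x * y))
      ((hasDerivAt_id y).const_mul x)).ofReal_comp
    refine h.congr_deriv ?_
    push_cast
    ring
  -- An antiderivative of the integrand on the left, up to the term in `B₂`.
  have hF : ∀ y : ℝ, HasDerivAt (fun y : ℝ => -((besselClifford 0 (x * y) : ℂ) / p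
      - x * (besselClifford 1 (x * y) : ℂ) / p ^ 2) * Complex.exp (-(p * y)))
      ((besselClifford 0 (x * y) : ℂ) * Complex.exp (-(p * y))
        - x ^ 2 / p ^ 2 * ((besselClifford 2 (x * y) : ℂ) * Complex.exp (-(p * y)))) y := by
    intro y
    have h := ((((hB 0 y).div_const p).sub
      (((hB 1 y).const_mul (x : ℂ)).div_const (p ^ 2))).neg).mul (hasDerivAt_cexp_neg_mul p y)
    refine h.congr_deriv ?_
    simp only [zero_add, one_add_one_eq_two, Pi.neg_apply, Pi.sub_apply]
    field_simp
    ring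
  have c0 := (continuous_besselClifford_mul_cexp 0 x p).intervalIntegrable (μ := volume) 0 Y
  have c2 := ((continuous_besselClifford_mul_cexp 2 x p).intervalIntegrable
    (μ := volume) 0 Y).const_mul ((x : ℂ) ^ 2 / p ^ 2)
  have h := intervalIntegral.integral_eq_sub_of_hasDerivAt (fun y _ => hF y) (c0.sub c2)
  rw [intervalIntegral.integral_sub c0 c2, intervalIntegral.integral_const_mul,
    sub_eq_iff_eq_add] at h
  rw [h]
  simp [besselClifford_apply_zero]
  ring

theorem integrableOn_besselClifford_two_mul_cexp {x : ℝ} (hx : 0 < x) {p : ℂ} (hp : 0 ≤ p.re) :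
    IntegrableOn (fun y : ℝ => (besselClifford 2 (x * y) : ℂ) * Complex.exp (-(p * y)))
      (Set.Ioi 0) := by
  refine Integrable.mono' (integrableOn_besselClifford_two_mul hx).norm
    (continuous_besselClifford_mul_cexp 2 x p).aestronglyMeasurable ?_
  refine (ae_restrict_mem measurableSet_Ioi).mono fun y hy => ?_
  rw [norm_mul, norm_exp_neg_mul, Complex.norm_real]
  refine mul_le_of_le_one_right (norm_nonneg _) (Real.exp_le_one_iff.2 ?_)
  have : 0 ≤ p.re * y := mul_nonneg hp (le_of_lt hy)
  linarith

/-- The boundary terms at `Y` vanish in the limit, also on the imaginary axis, because `B₀` and `B₁`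
tend to zero. -/
theorem tendsto_integral_besselClifford_aux {x : ℝ} (hx : 0 < x) {p : ℂ} (hp : 0 ≤ p.re)
    (hp0 : p ≠ 0) :
    Tendsto (fun Y : ℝ =>
      ∫ y in (0 : ℝ)..Y, (besselClifford 0 (x * y) : ℂ) * Complex.exp (-(p * y))) atTop
      (𝓝 (1 / p - x / p ^ 2 + x ^ 2 / p ^ 2 *
        ∫ y in Set.Ioi (0 : ℝ), (besselClifford 2 (x * y) : ℂ) * Complex.exp (-(p * y)))) := by
  simp_rw [integral_besselClifford_by_parts x hp0]
  have hxy : Tendsto (fun Y : ℝ => x * Y) atTop atTop := tendsto_id.const_mul_atTop hx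
  have h0 : Tendsto (fun Y : ℝ => (besselClifford 0 (x * Y) : ℂ)) atTop (𝓝 ((0 : ℝ) : ℂ)) :=
    (Complex.continuous_ofReal.tendsto 0).comp (tendsto_besselClifford_zero.comp hxy)
  have h1 : Tendsto (fun Y : ℝ => (besselClifford 1 (x * Y) : ℂ)) atTop (𝓝 ((0 : ℝ) : ℂ)) :=
    (Complex.continuous_ofReal.tendsto 0).comp (tendsto_besselClifford_one.comp hxy)
  have hb := (h0.div_const p).sub ((h1.const_mul (x : ℂ)).div_const (p ^ 2))
  simp only [Complex.ofReal_zero, zero_div, mul_zero, sub_zero] at hb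
  have hbdd : IsBoundedUnder (· ≤ ·) atTop (fun Y : ℝ => ‖Complex.exp (-(p * Y))‖) := by
    refine ⟨1, (eventually_ge_atTop 0).mono fun Y hY => ?_⟩
    change ‖Complex.exp (-(p * Y))‖ ≤ 1
    rw [norm_exp_neg_mul]
    exact Real.exp_le_one_iff.2 (neg_nonpos.2 (mul_nonneg hp hY))
  have hb' := hb.zero_mul_isBoundedUnder_le hbdd
  have hI := intervalIntegral_tendsto_integral_Ioi 0
    (integrableOn_besselClifford_two_mul_cexp hx hp) tendsto_id
  have := ((tendsto_const_nhds (x := 1 / p - x / p ^ 2)).sub hb').add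
    (hI.const_mul ((x : ℂ) ^ 2 / p ^ 2))
  simpa only [sub_zero, id] using this

/-- For `Re p > 0` the limit of the truncated integrals is also the absolutely convergent Laplace
transform of `B₀(xy)`; comparing the two evaluates the transform of `B₂(xy)`. -/
theorem laplace_besselClifford_two_of_re_pos {x : ℝ} (hx : 0 < x) {p : ℂ} (hp : 0 < p.re) :
    x ^ 2 * ∫ y in Set.Ioi (0 : ℝ), (besselClifford 2 (x * y) : ℂ) * Complex.exp (-(p * y))
      = p * Complex.exp (-(x / p)) - p + x := by
  have hp0 : p ≠ 0 := by rintro rfl; simp at hp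
  have h1 := tendsto_integral_besselClifford_aux hx hp.le hp0
  have h2 := intervalIntegral_tendsto_integral_Ioi 0
    (integrableOn_besselClifford_mul_cexp hx hp) tendsto_id
  rw [laplace_besselClifford_zero hx hp] at h2
  have h := tendsto_nhds_unique h1 h2
  field_simp at h
  linear_combination h

/-- Both sides are continuous on the closed half-plane without the origin, since `B₂` is integrable. -/
theorem laplace_besselClifford_two {x : ℝ} (hx : 0 < x) {p : ℂ} (hp : 0 ≤ p.re) (hp0 : p ≠ 0) :
    x ^ 2 * ∫ y in Set.Ioi (0 : ℝ), (besselClifford 2 (x * y) : ℂ) * Complex.exp (-(p * y))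
      = p * Complex.exp (-(x / p)) - p + x := by
  have hs : Tendsto (fun ε : ℝ => p + ε) (𝓝[>] 0) (𝓝 p) := by
    have : Continuous fun ε : ℝ => p + ε := by fun_prop
    simpa using (this.tendsto 0).mono_left nhdsWithin_le_nhds
  have hre : ∀ ε : ℝ, 0 < ε → 0 < (p + ε).re := by
    intro ε hε
    simp only [Complex.add_re, Complex.ofReal_re]
    linarith
  have hR : Tendsto (fun ε : ℝ => (p + ε) * Complex.exp (-(x / (p + ε))) - (p + ε) + x) (𝓝[>] 0)
      (𝓝 (p * Complex.exp (-(x / p)) - p + x)) := by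
    have hc : ContinuousAt (fun z : ℂ => z * Complex.exp (-(x / z)) - z + x) p := by
      fun_prop (disch := assumption)
    exact hc.tendsto.comp hs
  have hL : Tendsto (fun ε : ℝ => ∫ y in Set.Ioi (0 : ℝ),
      (besselClifford 2 (x * y) : ℂ) * Complex.exp (-((p + ε) * y))) (𝓝[>] 0)
      (𝓝 (∫ y in Set.Ioi (0 : ℝ), (besselClifford 2 (x * y) : ℂ) * Complex.exp (-(p * y)))) := by
    refine tendsto_integral_filter_of_dominated_convergence
      (fun y => ‖besselClifford 2 (x * y)‖)
      (Eventually.of_forall fun ε =>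
        (continuous_besselClifford_mul_cexp 2 x (p + ε)).aestronglyMeasurable) ?_
      (integrableOn_besselClifford_two_mul hx).norm ?_
    · filter_upwards [self_mem_nhdsWithin] with ε hε
      refine (ae_restrict_mem measurableSet_Ioi).mono fun y hy => ?_
      rw [norm_mul, norm_exp_neg_mul, Complex.norm_real]
      refine mul_le_of_le_one_right (norm_nonneg _) (Real.exp_le_one_iff.2 ?_)
      have : 0 ≤ (p + ε).re * y := mul_nonneg (hre ε hε).le (le_of_lt hy)
      linarith
    · refine Eventually.of_forall fun y => ?_
      have hc : Continuous fun z : ℂ =>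
          (besselClifford 2 (x * y) : ℂ) * Complex.exp (-(z * y)) := by fun_prop
      exact (hc.tendsto p).comp hs
  refine tendsto_nhds_unique (hL.const_mul ((x : ℂ) ^ 2)) (hR.congr' ?_)
  filter_upwards [self_mem_nhdsWithin] with ε hε
  exact (laplace_besselClifford_two_of_re_pos hx (hre ε hε)).symm

/-- The Laplace transform of `J₀(2√(xy))` is `e^{-x/p} / p` for `Re p ≥ 0`, `p ≠ 0`; on the
imaginary axis it converges only conditionally. -/
theorem tendsto_integral_besselClifford {x : ℝ} (hx : 0 < x) {p : ℂ} (hp : 0 ≤ p.re)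
    (hp0 : p ≠ 0) :
    Tendsto (fun Y : ℝ =>
      ∫ y in (0 : ℝ)..Y, (besselClifford 0 (x * y) : ℂ) * Complex.exp (-(p * y))) atTop
      (𝓝 (Complex.exp (-(x / p)) / p)) := by
  convert tendsto_integral_besselClifford_aux hx hp hp0 using 2
  rw [div_mul_eq_mul_div, laplace_besselClifford_two hx hp hp0]
  field_simp
  ring

/-- A bound for the truncated Laplace integrals that is uniform both in `p` and in large `Y`; it
dominates the passage to the limit under `dq`. -/
theorem exists_bound_integral_besselClifford {x : ℝ} (hx : 0 < x) : ∃ C : ℝ,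
    ∀ᶠ Y : ℝ in atTop, ∀ p : ℂ, 0 ≤ p.re → p ≠ 0 → ‖p‖ ≤ 1 →
      ‖∫ y in (0 : ℝ)..Y, (besselClifford 0 (x * y) : ℂ) * Complex.exp (-(p * y))‖
        ≤ C / ‖p‖ ^ 2 := by
  have hxy : Tendsto (fun Y : ℝ => x * Y) atTop atTop := tendsto_id.const_mul_atTop hx
  have hlt : ‖(0 : ℝ)‖ < 1 := by simp
  set M := ∫ y in Set.Ioi (0 : ℝ), ‖besselClifford 2 (x * y)‖ with hM
  refine ⟨2 + 2 * x + x ^ 2 * M, ?_⟩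
  filter_upwards [(tendsto_besselClifford_zero.comp hxy).norm.eventually (gt_mem_nhds hlt),
    (tendsto_besselClifford_one.comp hxy).norm.eventually (gt_mem_nhds hlt),
    eventually_ge_atTop 0] with Y h0 h1 hY p hp hp0 hp1
  have hpp : 0 < ‖p‖ := norm_pos_iff.2 hp0
  have hE : ∀ y : ℝ, 0 ≤ y → ‖Complex.exp (-(p * y))‖ ≤ 1 := by
    intro y hy
    rw [norm_exp_neg_mul]
    exact Real.exp_le_one_iff.2 (neg_nonpos.2 (mul_nonneg hp hy))
  have hI : ‖∫ y in (0 : ℝ)..Y, (besselClifford 2 (x * y) : ℂ) * Complex.exp (-(p * y))‖ ≤ M := by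
    rw [intervalIntegral.integral_of_le hY]
    have hi : IntegrableOn (fun y => ‖besselClifford 2 (x * y)‖) (Set.Ioi 0) :=
      (integrableOn_besselClifford_two_mul hx).norm
    calc _ ≤ ∫ y in Set.Ioc 0 Y, ‖besselClifford 2 (x * y)‖ := by
          refine norm_integral_le_of_norm_le (hi.mono_set Set.Ioc_subset_Ioi_self) ?_
          refine (ae_restrict_mem measurableSet_Ioc).mono fun y hy => ?_
          rw [norm_mul, Complex.norm_real]
          exact mul_le_of_le_one_right (norm_nonneg _) (hE y hy.1.le)
      _ ≤ M := setIntegral_mono_set hi (Eventually.of_forall fun y => norm_nonneg _)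
          (Eventually.of_forall Set.Ioc_subset_Ioi_self)
  rw [integral_besselClifford_by_parts x hp0]
  have hinv : 1 / ‖p‖ ≤ 1 / ‖p‖ ^ 2 :=
    one_div_le_one_div_of_le (by positivity) (by nlinarith)
  have e1 : ‖1 / p - x / p ^ 2‖ ≤ (1 + x) / ‖p‖ ^ 2 := by
    refine (norm_sub_le _ _).trans ?_
    simp only [norm_div, norm_one, Complex.norm_real, norm_pow, Real.norm_of_nonneg hx.le]
    rw [add_div]
    gcongr
  have e2 : ‖((besselClifford 0 (x * Y) : ℂ) / p - x * (besselClifford 1 (x * Y) : ℂ) / p ^ 2)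
          * Complex.exp (-(p * Y))‖ ≤ (1 + x) / ‖p‖ ^ 2 := by
    rw [norm_mul]
    refine (mul_le_of_le_one_right (norm_nonneg _) (hE Y hY)).trans ((norm_sub_le _ _).trans ?_)
    simp only [norm_div, norm_mul, Complex.norm_real, norm_pow, Real.norm_of_nonneg hx.le]
    rw [add_div]
    simp only [Function.comp_apply] at h0 h1
    refine add_le_add (le_trans ?_ hinv) ?_
    · gcongr
    · gcongr
      exact mul_le_of_le_one_right hx.le h1.le
  have e3 : ‖(x : ℂ) ^ 2 / p ^ 2 *
      ∫ y in (0 : ℝ)..Y, (besselClifford 2 (x * y) : ℂ) * Complex.exp (-(p * y))‖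
      ≤ x ^ 2 * M / ‖p‖ ^ 2 := by
    simp only [norm_div, norm_mul, Complex.norm_real, norm_pow, Real.norm_of_nonneg hx.le]
    rw [mul_div_right_comm]
    gcongr
  calc _ ≤ _ + _ + _ := norm_add_le_of_le (norm_sub_le_of_le e1 e2) e3
    _ = _ := by ring

/-! ### Functional equations and continuity of the question mark function -/

theorem questionMark_zero : questionMark 0 = 0 := by
  rw [questionMark_eq, qFrac_of_fract_eq_zero (by simp)]; simp

theorem questionMark_one : questionMark 1 = 1 := by
  rw [questionMark_eq, qFrac_of_fract_eq_zero (by simp)]; simp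

theorem questionMark_add_intCast (x : ℝ) (n : ℤ) :
    questionMark (x + n) = questionMark x + n := by
  have hq : qFrac (x + n) = qFrac x := by
    by_cases h : Int.fract x = 0
    · rw [qFrac_of_fract_eq_zero h, qFrac_of_fract_eq_zero (by simpa using h)]
    · rw [qFrac_eq h, qFrac_eq (by simpa using h), Int.fract_add_intCast]
  rw [questionMark_eq, questionMark_eq, hq]
  simp
  ring

/-- The self-similarity of the question mark function. The endpoint `s = 1` corresponds to the other
finite continued fraction of `1/(n+1)`. -/
theorem questionMark_inv_add {n : ℕ} (hn : 1 ≤ n) {s : ℝ} (hs : s ∈ Set.Icc (0 : ℝ) 1) :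
    questionMark (n + s)⁻¹ = 2⁻¹ ^ n * (2 - questionMark s) := by
  have main : ∀ (n : ℕ) (s : ℝ), 1 ≤ n → 0 ≤ s → s < 1 →
      questionMark (n + s)⁻¹ = 2⁻¹ ^ n * (2 - questionMark s) := by
    intro n s hn h0 h1
    have hn' : (1 : ℝ) ≤ n := by exact_mod_cast hn
    rcases (show (1 : ℝ) ≤ n + s by linarith).eq_or_lt with h | h
    · have hs0 : s = 0 := by linarith
      have hn1 : (n : ℝ) = 1 := by linarith
      rw [← h, inv_one, questionMark_one, hs0, questionMark_zero]
      rw [Nat.cast_eq_one.1 hn1]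
      norm_num
    · have hlt : ((n : ℝ) + s)⁻¹ < 1 := inv_lt_one_of_one_lt₀ h
      have hpos : 0 < ((n : ℝ) + s)⁻¹ := by positivity
      have hfl : ⌊((n : ℝ) + s)⁻¹⌋ = 0 := Int.floor_eq_zero_iff.2 ⟨hpos.le, hlt⟩
      have hfr : Int.fract ((n : ℝ) + s)⁻¹ = ((n : ℝ) + s)⁻¹ := Int.fract_eq_self.2 ⟨hpos.le, hlt⟩
      have hfl' : ⌊(n : ℝ) + s⌋ = n := by
        rw [Int.floor_natCast_add, Int.floor_eq_zero_iff.2 ⟨h0, h1⟩, add_zero]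
      have hq : qFrac ((n : ℝ) + s) = questionMark s := by
        have := questionMark_add_intCast s n
        rw [add_comm, questionMark_eq] at this
        push_cast at this
        rw [hfl'] at this
        push_cast at this
        linarith
      rw [questionMark_eq, hfl, qFrac_eq (by rw [hfr]; exact hpos.ne'), hfr, inv_inv, hfl', hq]
      simp [Real.rpow_neg]
  rcases hs.2.eq_or_lt with h | h
  · have := main (n + 1) 0 (by omega) le_rfl zero_lt_one
    subst h
    push_cast at this
    rw [add_zero] at this
    rw [this, questionMark_zero, questionMark_one]
    ring
  · exact main n s hn hs.1 h

theorem exists_eq_inv_add {x : ℝ} (hx : x ∈ Set.Ioc (0 : ℝ) 1) :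
    ∃ (n : ℕ) (s : ℝ), 1 ≤ n ∧ s ∈ Set.Icc (0 : ℝ) 1 ∧ x = (n + s)⁻¹ := by
  have h1 : 1 ≤ x⁻¹ := (one_le_inv₀ hx.1).2 hx.2
  refine ⟨⌊x⁻¹⌋₊, Int.fract x⁻¹, Nat.le_floor (by simpa using h1),
    ⟨Int.fract_nonneg _, (Int.fract_lt_one _).le⟩, ?_⟩
  rw [natCast_floor_eq_intCast_floor (by linarith), Int.floor_add_fract, inv_inv]

theorem questionMark_div_one_add {x : ℝ} (hx : x ∈ Set.Icc (0 : ℝ) 1) :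
    questionMark (x / (1 + x)) = questionMark x / 2 := by
  rcases hx.1.eq_or_lt with rfl | h0
  · simp [questionMark_zero]
  obtain ⟨n, s, hn, hs, rfl⟩ := exists_eq_inv_add ⟨h0, hx.2⟩
  have hn' : (1 : ℝ) ≤ n := by exact_mod_cast hn
  have e : ((n : ℝ) + s)⁻¹ / (1 + ((n : ℝ) + s)⁻¹) = ((n + 1 : ℕ) + s)⁻¹ := by
    have h1 : (n : ℝ) + s ≠ 0 := by linarith [hs.1]
    have h2 : (n : ℝ) + 1 + s ≠ 0 := by linarith [hs.1]
    have h3 : (n : ℝ) + s + 1 ≠ 0 := by linarith [hs.1]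
    push_cast
    field_simp
    ring
  rw [e, questionMark_inv_add (by omega) hs, questionMark_inv_add hn hs, pow_succ]
  ring

/-- For `x ≤ 1/2` put `v = x/(1-x)`. Then `1 - x = 1/(1+v)` and `x = v/(1+v)`, so both values are
determined by `?(v)`. -/
theorem questionMark_one_sub {x : ℝ} (hx : x ∈ Set.Icc (0 : ℝ) 1) :
    questionMark (1 - x) = 1 - questionMark x := by
  have half : ∀ x : ℝ, 0 ≤ x → x ≤ 1 / 2 → questionMark (1 - x) = 1 - questionMark x := by
    intro x h0 h2
    have hv : x / (1 - x) ∈ Set.Icc (0 : ℝ) 1 :=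
      ⟨div_nonneg h0 (by linarith), (div_le_one (by linarith)).2 (by linarith)⟩
    have h1x : 1 - x ≠ 0 := by linarith
    have e1 : (1 - x) = ((1 : ℕ) + x / (1 - x))⁻¹ := by
      push_cast; field_simp; ring
    have e2 : x = x / (1 - x) / (1 + x / (1 - x)) := by
      field_simp; ring
    have h3 := questionMark_inv_add le_rfl hv
    have h4 := questionMark_div_one_add hv
    rw [← e1] at h3
    rw [← e2] at h4
    rw [h3, h4]
    ring
  rcases le_total x (1 / 2) with h | h
  · exact half x hx.1 h
  · have := half (1 - x) (by linarith [hx.2]) (by linarith)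
    rw [sub_sub_cancel] at this
    linarith

/-- The image of `[0, 1]` is stable under `r ↦ r/2` and `r ↦ 1 - r`, which generate all dyadic
rationals from `0` and `1`. -/
theorem dyadic_mem_image_questionMark (n k : ℕ) (hk : k ≤ 2 ^ n) :
    (k : ℝ) / 2 ^ n ∈ questionMark '' Set.Icc 0 1 := by
  induction n generalizing k with
  | zero =>
    rw [pow_zero] at hk
    interval_cases k
    · exact ⟨0, by simp, by simp [questionMark_zero]⟩
    · exact ⟨1, by simp, by simp [questionMark_one]⟩
  | succ n ih =>
    have half : ∀ k : ℕ, k ≤ 2 ^ n → (k : ℝ) / 2 ^ (n + 1) ∈ questionMark '' Set.Icc 0 1 := by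
      intro k hk
      obtain ⟨x, hx, hxk⟩ := ih k hk
      refine ⟨x / (1 + x), ⟨div_nonneg hx.1 (by linarith [hx.1]),
        (div_le_one (by linarith [hx.1])).2 (by linarith)⟩, ?_⟩
      rw [questionMark_div_one_add hx, hxk, pow_succ]
      field_simp
    rcases le_total k (2 ^ n) with h | h
    · exact half k h
    · obtain ⟨x, hx, hxk⟩ := half (2 ^ (n + 1) - k) (by rw [pow_succ]; omega)
      refine ⟨1 - x, ⟨by linarith [hx.2], by linarith [hx.1]⟩, ?_⟩
      rw [questionMark_one_sub hx, hxk, Nat.cast_sub hk]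
      push_cast
      field_simp
      ring

/-- A monotone function whose range contains the dyadic rationals has no jumps. -/
theorem continuous_questionMark : Continuous questionMark := by
  refine questionMark_mono.continuous_of_denseRange (dense_iff_exists_between.2 fun a b hab => ?_)
  obtain ⟨n, hn⟩ := exists_pow_lt_of_lt_one (sub_pos.2 hab) (show (1 / 2 : ℝ) < 1 by norm_num)
  set N : ℝ := 2 ^ n with hN
  have hN0 : 0 < N := by positivity
  have hN1 : (1 / 2 : ℝ) ^ n = 1 / N := by rw [hN, one_div_pow]
  set m : ℤ := ⌊a * N⌋ + 1 with hm
  have hm1 : a < m / N := by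
    rw [lt_div_iff₀ hN0, hm]; push_cast; exact Int.lt_floor_add_one _
  have hm2 : m / N < b := by
    have h1 : (m : ℝ) ≤ a * N + 1 := by rw [hm]; push_cast; linarith [Int.floor_le (a * N)]
    have h2 : (m : ℝ) / N ≤ a + 1 / N := by
      rw [div_le_iff₀ hN0, add_mul, one_div_mul_cancel hN0.ne']; exact h1
    rw [hN1] at hn
    linarith
  refine ⟨m / N, ?_, hm1, hm2⟩
  have hp : (0 : ℤ) < 2 ^ n := by positivity
  obtain ⟨k, hk⟩ := Int.eq_ofNat_of_zero_le (Int.emod_nonneg m hp.ne')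
  have hk2 : k ≤ 2 ^ n := by
    have := Int.emod_lt_of_pos m hp
    rw [hk] at this
    exact_mod_cast this.le
  obtain ⟨x, -, hxk⟩ := dyadic_mem_image_questionMark n k hk2
  refine ⟨x + (m / 2 ^ n : ℤ), ?_⟩
  rw [questionMark_add_intCast, hxk]
  have h3 : (m : ℝ) = k + N * (m / 2 ^ n : ℤ) := by
    have := Int.emod_add_mul_ediv m (2 ^ n)
    rw [hk] at this
    rw [hN]
    exact_mod_cast this.symm
  rw [h3, ← hN]
  field_simp

theorem dq_Icc (a b : ℝ) :
    dq (Set.Icc a b) = ENNReal.ofReal (questionMark b - questionMark a) := by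
  have h : ∀ x, questionMark_mono.stieltjesFunction x = questionMark x := fun x => by
    rw [questionMark_mono.stieltjesFunction_eq,
      continuous_questionMark.continuousAt.continuousWithinAt.rightLim_eq]
  have h' : (questionMark_mono.stieltjesFunction : ℝ → ℝ) = questionMark := funext h
  rw [dq, StieltjesFunction.measure_Icc, h',
    continuous_questionMark.continuousAt.continuousWithinAt.leftLim_eq]

instance : IsLocallyFiniteMeasure dq := by unfold dq; infer_instance

instance : NullSingletonClass dq := ⟨fun a => by rw [← Set.Icc_self, dq_Icc]; simp⟩

instance : IsFiniteMeasure (dq.restrict (Set.Icc (0 : ℝ) 1)) :=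
  isFiniteMeasure_restrict.2 (by rw [dq_Icc]; exact ENNReal.ofReal_ne_top)

/-- If the question mark function transforms affinely, with factor `-c`, under a decreasing change of
variables `φ` of `[0, 1]`, then `dq` on the image interval is `c` times the image of `dq`. -/
theorem map_dq_restrict {φ : ℝ → ℝ} {c A : ℝ} (hc : 0 ≤ c) (hφ : Measurable φ)
    (hcont : ContinuousOn φ (Set.Icc 0 1)) (hanti : StrictAntiOn φ (Set.Icc 0 1))
    (hQ : ∀ s ∈ Set.Icc (0 : ℝ) 1, questionMark (φ s) = A - c * questionMark s) :
    ENNReal.ofReal c • (dq.restrict (Set.Icc 0 1)).map φ =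
      dq.restrict (Set.Icc (φ 1) (φ 0)) := by
  have : IsFiniteMeasure (dq.restrict (Set.Icc (φ 1) (φ 0))) :=
    isFiniteMeasure_restrict.2 (by rw [dq_Icc]; exact ENNReal.ofReal_ne_top)
  have h0 : (0 : ℝ) ∈ Set.Icc (0 : ℝ) 1 := by simp
  have h1 : (1 : ℝ) ∈ Set.Icc (0 : ℝ) 1 := by simp
  symm
  refine Measure.ext_of_Iic _ _ fun a => ?_
  rw [Measure.smul_apply, Measure.map_apply hφ measurableSet_Iic,
    Measure.restrict_apply measurableSet_Iic, Measure.restrict_apply (hφ measurableSet_Iic)]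
  -- It suffices to compare distribution functions at the values of `φ`.
  have main : ∀ u ∈ Set.Icc (0 : ℝ) 1,
      dq (Set.Iic (φ u) ∩ Set.Icc (φ 1) (φ 0)) =
        ENNReal.ofReal c • dq (φ ⁻¹' Set.Iic (φ u) ∩ Set.Icc 0 1) := by
    intro u hu
    have e1 : Set.Iic (φ u) ∩ Set.Icc (φ 1) (φ 0) = Set.Icc (φ 1) (φ u) := by
      ext t
      simp only [Set.mem_inter_iff, Set.mem_Iic, Set.mem_Icc]
      exact ⟨fun h => ⟨h.2.1, h.1⟩,
        fun h => ⟨h.2, h.1, h.2.trans (hanti.antitoneOn h0 hu hu.1)⟩⟩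
    have e2 : φ ⁻¹' Set.Iic (φ u) ∩ Set.Icc 0 1 = Set.Icc u 1 := by
      ext t
      simp only [Set.mem_inter_iff, Set.mem_preimage, Set.mem_Iic, Set.mem_Icc]
      exact ⟨fun h => ⟨(hanti.le_iff_ge ⟨h.2.1, h.2.2⟩ hu).1 h.1, h.2.2⟩,
        fun h => ⟨hanti.antitoneOn hu ⟨hu.1.trans h.1, h.2⟩ h.1, hu.1.trans h.1, h.2⟩⟩
    rw [e1, e2, dq_Icc, dq_Icc, hQ u hu, hQ 1 h1, smul_eq_mul, ← ENNReal.ofReal_mul hc]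
    congr 1
    ring
  rcases lt_or_ge a (φ 1) with ha | ha
  · have e1 : Set.Iic a ∩ Set.Icc (φ 1) (φ 0) = ∅ := by
      ext t
      simp only [Set.mem_inter_iff, Set.mem_Iic, Set.mem_Icc, Set.mem_empty_iff_false, iff_false]
      intro h
      linarith [h.1, h.2.1]
    have e2 : φ ⁻¹' Set.Iic a ∩ Set.Icc 0 1 = ∅ := by
      ext t
      simp only [Set.mem_inter_iff, Set.mem_preimage, Set.mem_Iic, Set.mem_empty_iff_false,
        iff_false]
      intro h
      linarith [h.1, hanti.antitoneOn h.2 h1 h.2.2]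
    rw [e1, e2]
    simp
  rcases le_or_gt a (φ 0) with hb | hb
  · obtain ⟨u, hu, rfl⟩ := intermediate_value_Icc' zero_le_one hcont ⟨ha, hb⟩
    exact main u hu
  · have e1 : Set.Iic a ∩ Set.Icc (φ 1) (φ 0) = Set.Iic (φ 0) ∩ Set.Icc (φ 1) (φ 0) := by
      ext t
      simp only [Set.mem_inter_iff, Set.mem_Iic, Set.mem_Icc]
      exact ⟨fun h => ⟨h.2.2, h.2⟩, fun h => ⟨h.1.trans hb.le, h.2⟩⟩
    have e2 : φ ⁻¹' Set.Iic a ∩ Set.Icc 0 1 = φ ⁻¹' Set.Iic (φ 0) ∩ Set.Icc 0 1 := by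
      ext t
      simp only [Set.mem_inter_iff, Set.mem_preimage, Set.mem_Iic]
      exact ⟨fun h => ⟨hanti.antitoneOn h0 h.2 h.2.1, h.2⟩, fun h => ⟨h.1.trans hb.le, h.2⟩⟩
    rw [e1, e2]
    exact main 0 h0

theorem map_one_sub_dq :
    (dq.restrict (Set.Icc 0 1)).map (fun t : ℝ => 1 - t) = dq.restrict (Set.Icc 0 1) := by
  have h := map_dq_restrict (φ := fun t : ℝ => 1 - t) (c := 1) (A := 1) zero_le_one
    (by fun_prop) (by fun_prop) (fun a _ b _ hab => by simpa using hab)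
    (fun s hs => by rw [questionMark_one_sub hs, one_mul])
  simpa using h

theorem map_inv_add_dq {n : ℕ} (hn : 1 ≤ n) :
    ENNReal.ofReal (2⁻¹ ^ n) • (dq.restrict (Set.Icc 0 1)).map (fun t : ℝ => (n + t)⁻¹) =
      dq.restrict (Set.Icc ((n : ℝ) + 1)⁻¹ (n : ℝ)⁻¹) := by
  have hn' : (1 : ℝ) ≤ n := by exact_mod_cast hn
  have h := map_dq_restrict (φ := fun t : ℝ => ((n : ℝ) + t)⁻¹) (c := 2⁻¹ ^ n)
    (A := 2⁻¹ ^ n * 2) (by positivity) (by fun_prop)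
    (ContinuousOn.inv₀ (by fun_prop) (fun t ht => by linarith [ht.1]))
    (fun a ha b hb hab => inv_strictAnti₀ (by linarith [ha.1]) (by linarith))
    (fun s hs => by rw [questionMark_inv_add hn hs]; ring)
  simpa using h

/-! ### Integrals against `dq` -/

theorem iUnion_Ioc_inv : ⋃ n : ℕ, Set.Ioc ((n : ℝ) + 1 + 1)⁻¹ ((n : ℝ) + 1)⁻¹ = Set.Ioc 0 1 := by
  ext t
  simp only [Set.mem_iUnion, Set.mem_Ioc]
  constructor
  · rintro ⟨n, h1, h2⟩
    exact ⟨lt_trans (by positivity) h1, h2.trans (inv_le_one_of_one_le₀ (by simp))⟩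
  · rintro ⟨h0, h1⟩
    have hi : 1 ≤ t⁻¹ := (one_le_inv₀ h0).2 h1
    have hfl : 1 ≤ ⌊t⁻¹⌋₊ := Nat.le_floor (by simpa using hi)
    refine ⟨⌊t⁻¹⌋₊ - 1, ?_, ?_⟩
    all_goals rw [Nat.cast_sub hfl, Nat.cast_one, sub_add_cancel]
    · rw [inv_lt_comm₀ (by positivity) h0]
      exact Nat.lt_floor_add_one _
    · rw [le_inv_comm₀ h0 (by exact_mod_cast hfl)]
      exact Nat.floor_le (by linarith)

theorem pairwise_disjoint_Ioc_inv : Pairwise (Function.onFun Disjoint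
    fun n : ℕ => Set.Ioc ((n : ℝ) + 1 + 1)⁻¹ ((n : ℝ) + 1)⁻¹) := by
  have h : Antitone fun n : ℕ => ((n : ℝ) + 1)⁻¹ := fun a b hab => by
    have : (a : ℝ) ≤ b := by exact_mod_cast hab
    exact inv_anti₀ (by positivity) (by linarith)
  simpa using h.pairwise_disjoint_on_Ioc_succ

/-- On `(1/(n+1), 1/n]` the integrand is at most `(n+1)²` and the mass is `2⁻ⁿ`. At `t = 0` the
integrand is the junk value `0`, which is harmless since `dq` has no atoms. -/
theorem integrableOn_inv_sq : IntegrableOn (fun t : ℝ => (t ^ 2)⁻¹) (Set.Icc 0 1) dq := by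
  rw [integrableOn_Icc_iff_integrableOn_Ioc, ← iUnion_Ioc_inv]
  have hle : ∀ n : ℕ, ((n : ℝ) + 1 + 1)⁻¹ ≤ ((n : ℝ) + 1)⁻¹ := fun n =>
    inv_anti₀ (by positivity) (by linarith)
  refine integrableOn_iUnion_of_summable_integral_norm (fun n => ?_) ?_
  · refine IntegrableOn.mono_set (ContinuousOn.integrableOn_Icc ?_) Set.Ioc_subset_Icc_self
    refine ContinuousOn.inv₀ (by fun_prop) fun t ht => ?_
    have : 0 < t := lt_of_lt_of_le (by positivity) ht.1
    positivity
  · have hs : Summable fun n : ℕ => ((n + 1 : ℕ) + 1 : ℝ) ^ 2 * 2⁻¹ ^ (n + 1) := by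
      have h1 := summable_pow_mul_geometric_of_norm_lt_one (R := ℝ) 2
        (r := 2⁻¹) (by norm_num)
      have h2 := (((summable_nat_add_iff 2).2 h1).mul_left 2)
      refine h2.congr fun n => ?_
      push_cast
      ring
    refine Summable.of_nonneg_of_le (fun n => integral_nonneg fun t => norm_nonneg _)
      (fun n => ?_) hs
    have hm : dq (Set.Ioc ((n : ℝ) + 1 + 1)⁻¹ ((n : ℝ) + 1)⁻¹) = ENNReal.ofReal (2⁻¹ ^ (n + 1)) := by
      have e0 := questionMark_inv_add (n := n + 1) (by omega) (s := 0) (by simp)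
      have e1 := questionMark_inv_add (n := n + 1) (by omega) (s := 1) (by simp)
      push_cast at e0 e1
      rw [add_zero] at e0
      rw [measure_congr Ioc_ae_eq_Icc, dq_Icc, e0, e1, questionMark_zero, questionMark_one]
      congr 1
      ring
    have hb := norm_setIntegral_le_of_norm_le_const (μ := dq)
      (s := Set.Ioc ((n : ℝ) + 1 + 1)⁻¹ ((n : ℝ) + 1)⁻¹) (f := fun t : ℝ => ‖(t ^ 2)⁻¹‖)
      (C := ((n + 1 : ℕ) + 1 : ℝ) ^ 2) (by rw [hm]; exact ENNReal.ofReal_lt_top) (fun t ht => by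
        have h0 : 0 < t := lt_of_le_of_lt (by positivity) ht.1
        have h1 : t⁻¹ ≤ (n : ℝ) + 1 + 1 := by
          rw [inv_le_comm₀ h0 (by positivity)]; exact ht.1.le
        rw [norm_norm, Real.norm_of_nonneg (by positivity), ← inv_pow]
        push_cast
        gcongr)
    rw [Measure.real, hm, ENNReal.toReal_ofReal (by positivity)] at hb
    exact (le_abs_self _).trans hb

/-- `dq` on `[0, 1]` is the sum of `2⁻ⁿ` times its images under `s ↦ 1/(n+s)`, `n ≥ 1`. -/
theorem hasSum_integral_dq {g : ℝ → ℂ} (hg : Measurable g)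
    (hint : IntegrableOn g (Set.Icc 0 1) dq) :
    HasSum (fun n : ℕ => (2⁻¹ : ℂ) ^ (n + 1) *
        ∫ s in Set.Icc (0 : ℝ) 1, g (((n + 1 : ℕ) + s : ℝ)⁻¹) ∂dq)
      (∫ t in Set.Icc (0 : ℝ) 1, g t ∂dq) := by
  have h := hasSum_integral_iUnion (μ := dq) (f := g) (fun n : ℕ => measurableSet_Ioc)
    pairwise_disjoint_Ioc_inv (by
      rw [iUnion_Ioc_inv]; exact hint.mono_set Set.Ioc_subset_Icc_self)
  rw [iUnion_Ioc_inv, ← integral_Icc_eq_integral_Ioc] at h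
  have key : ∀ n : ℕ, ∫ t in Set.Ioc ((n : ℝ) + 1 + 1)⁻¹ ((n : ℝ) + 1)⁻¹, g t ∂dq =
      (2⁻¹ : ℂ) ^ (n + 1) * ∫ s in Set.Icc (0 : ℝ) 1, g (((n + 1 : ℕ) + s : ℝ)⁻¹) ∂dq := by
    intro n
    have hm := map_inv_add_dq (n := n + 1) (by omega)
    push_cast at hm
    rw [← integral_Icc_eq_integral_Ioc, ← hm, integral_smul_measure,
      integral_map (by fun_prop) hg.aestronglyMeasurable, ENNReal.toReal_ofReal (by positivity),
      Complex.real_smul]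
    push_cast
    rfl
  simpa only [key] using h

theorem hasDerivAt_fourierStieltjes (x : ℝ) :
    HasDerivAt fourierStieltjes
      (Complex.I * ∫ t in Set.Icc (0 : ℝ) 1, t * Complex.exp (Complex.I * x * t) ∂dq) x := by
  have hn : ∀ y t : ℝ, ‖Complex.exp (Complex.I * y * t)‖ = 1 := fun y t => by
    rw [Complex.norm_exp]; simp
  have h := (hasDerivAt_integral_of_dominated_loc_of_deriv_le (𝕜 := ℝ)
    (μ := dq.restrict (Set.Icc 0 1)) (s := Set.univ) (x₀ := x) (bound := fun _ => 1)
    (F := fun y t : ℝ => Complex.exp (Complex.I * y * t))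
    (F' := fun y t : ℝ => Complex.I * (t * Complex.exp (Complex.I * y * t)))
    univ_mem (Eventually.of_forall fun y => Continuous.aestronglyMeasurable (by fun_prop))
    ?_ (Continuous.aestronglyMeasurable (by fun_prop)) ?_ (integrable_const _) ?_).2
  · rw [integral_const_mul] at h
    exact h
  · exact Integrable.of_bound (Continuous.aestronglyMeasurable (by fun_prop)) 1
      (Eventually.of_forall fun t => (hn x t).le)
  · refine (ae_restrict_mem measurableSet_Icc).mono fun t ht y _ => ?_
    rw [norm_mul, norm_mul, hn, Complex.norm_I, Complex.norm_real, Real.norm_of_nonneg ht.1]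
    linarith [ht.2]
  · refine Eventually.of_forall fun t y _ => ?_
    have h := (((Complex.ofRealCLM.hasDerivAt (x := y)).const_mul Complex.I).mul_const (t : ℂ)).cexp
    refine h.congr_deriv ?_
    simp
    ring

/-- The symmetry `t ↦ 1 - t` of `dq` turns `e^{-iy} e^{iyt}` into `e^{-iyt}`. -/
theorem exp_neg_mul_fourierStieltjes (y : ℝ) :
    Complex.exp (-(Complex.I * y)) * fourierStieltjes y =
      ∫ t in Set.Icc (0 : ℝ) 1, Complex.exp (-(Complex.I * t * y)) ∂dq := by
  rw [fourierStieltjes, ← map_one_sub_dq, integral_map (by fun_prop)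
    (Continuous.aestronglyMeasurable (by fun_prop)), map_one_sub_dq, ← integral_const_mul]
  refine integral_congr_ae (Eventually.of_forall fun t => ?_)
  simp only
  rw [← Complex.exp_add]
  push_cast
  ring_nf

theorem integral_besselClifford_mul_fourierStieltjes (x Y : ℝ) :
    ∫ y in (0 : ℝ)..Y, (besselClifford 0 (x * y) : ℂ) *
        (Complex.exp (-(Complex.I * y)) * fourierStieltjes y) =
      ∫ t in Set.Icc (0 : ℝ) 1, (∫ y in (0 : ℝ)..Y,
        (besselClifford 0 (x * y) : ℂ) * Complex.exp (-(Complex.I * t * y))) ∂dq := by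
  simp_rw [exp_neg_mul_fourierStieltjes, ← integral_const_mul]
  refine intervalIntegral_integral_swap ?_
  have hc : Continuous fun y => besselClifford 0 (x * y) :=
    (continuous_besselClifford 0).comp (by fun_prop)
  obtain ⟨C, hC⟩ := (isCompact_uIcc (a := (0 : ℝ)) (b := Y)).exists_bound_of_continuousOn
    hc.continuousOn
  have : IsFiniteMeasure (volume.restrict (Set.uIoc 0 Y)) :=
    isFiniteMeasure_restrict.2 (by rw [Set.uIoc]; simp)
  refine Integrable.of_bound (Continuous.aestronglyMeasurable ?_) C ?_
  · simp only [Function.uncurry_def]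
    have := hc.comp continuous_fst (X := ℝ × ℝ)
    simp only [Function.comp_def] at this
    fun_prop
  · have hae : ∀ᵐ y ∂(volume.restrict (Set.uIoc 0 Y)), ‖besselClifford 0 (x * y)‖ ≤ C :=
      (ae_restrict_mem measurableSet_uIoc).mono fun y hy => hC y (Set.uIoc_subset_uIcc hy)
    have := (Measure.quasiMeasurePreserving_fst (μ := volume.restrict (Set.uIoc 0 Y))
      (ν := dq.restrict (Set.Icc (0 : ℝ) 1))).ae hae
    refine this.mono fun q hq => ?_
    have h1 : ‖Complex.exp (-(Complex.I * q.2 * q.1))‖ = 1 := by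
      rw [Complex.norm_exp]; simp
    simp only [Function.uncurry_def]
    rw [norm_mul, h1, Complex.norm_real, mul_one]
    exact hq

theorem ae_mem_Ioc_dq : ∀ᵐ t ∂(dq.restrict (Set.Icc (0 : ℝ) 1)), t ∈ Set.Ioc (0 : ℝ) 1 := by
  rw [← restrict_Ioc_eq_restrict_Icc]
  exact ae_restrict_mem measurableSet_Ioc

theorem tendsto_integral_besselClifford_mul_fourierStieltjes {x : ℝ} (hx : 0 < x) :
    Tendsto (fun Y : ℝ => ∫ y in (0 : ℝ)..Y, (besselClifford 0 (x * y) : ℂ) *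
        (Complex.exp (-(Complex.I * y)) * fourierStieltjes y)) atTop
      (𝓝 (∫ t in Set.Icc (0 : ℝ) 1,
        Complex.exp (-(x / (Complex.I * t))) / (Complex.I * t) ∂dq)) := by
  simp_rw [integral_besselClifford_mul_fourierStieltjes]
  obtain ⟨C, hC⟩ := exists_bound_integral_besselClifford hx
  refine tendsto_integral_filter_of_dominated_convergence (fun t => C * (t ^ 2)⁻¹) ?_ ?_
    (integrableOn_inv_sq.const_mul C) ?_
  · refine Eventually.of_forall fun Y => Continuous.aestronglyMeasurable ?_
    refine intervalIntegral.continuous_parametric_intervalIntegral_of_continuous' ?_ 0 Y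
    have := continuous_besselClifford 0
    simp only [Function.uncurry_def]
    fun_prop
  · filter_upwards [hC] with Y hY
    filter_upwards [ae_mem_Ioc_dq] with t ht
    have h := hY (Complex.I * t) (by simp) (by simp [ht.1.ne'])
      (by simpa [abs_of_pos ht.1] using ht.2)
    refine h.trans (le_of_eq ?_)
    rw [norm_mul, Complex.norm_I, one_mul, Complex.norm_real, Real.norm_of_nonneg ht.1.le,
      div_eq_mul_inv]
  · filter_upwards [ae_mem_Ioc_dq] with t ht
    exact tendsto_integral_besselClifford hx (by simp) (by simp [ht.1.ne'])

theorem hasSum_succ_mul_pow_add_pow {w : ℂ} (hw : ‖w‖ < 1) (a b c : ℂ) :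
    HasSum (fun n : ℕ => c * (a * ((n + 1 : ℕ) * w ^ (n + 1)) + b * w ^ (n + 1)))
      (c * (a * (w / (1 - w) ^ 2) + b * (w / (1 - w)))) := by
  have h1 : HasSum (fun n : ℕ => ((n + 1 : ℕ) : ℂ) * w ^ (n + 1)) (w / (1 - w) ^ 2) := by
    have := (hasSum_nat_add_iff' (f := fun n : ℕ => (n : ℂ) * w ^ n) 1).2
      (hasSum_coe_mul_geometric_of_norm_lt_one hw)
    rwa [Finset.sum_range_one, Nat.cast_zero, zero_mul, sub_zero] at this
  have h2 : HasSum (fun n : ℕ => w ^ (n + 1)) (w / (1 - w)) := by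
    simp_rw [pow_succ']
    exact (hasSum_geometric_of_norm_lt_one hw).mul_left w
  exact ((h1.mul_left a).add (h2.mul_left b)).mul_left c

/-- Self-similarity turns the integral of `e^{ix/t} / (it)` into a power series in `e^{ix}/2` with
coefficients `n f(x) - i f'(x)`, up to the factor `-i`. -/
theorem integral_exp_div_dq (x : ℝ) :
    ∫ t in Set.Icc (0 : ℝ) 1, Complex.exp (-(x / (Complex.I * t))) / (Complex.I * t) ∂dq =
      -(Complex.exp (Complex.I * x) / (2 - Complex.exp (Complex.I * x)) *
          (deriv fourierStieltjes x +
            2 * Complex.I * fourierStieltjes x / (2 - Complex.exp (Complex.I * x)))) := by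
  set z := Complex.exp (Complex.I * x) with hz
  set M := ∫ t in Set.Icc (0 : ℝ) 1, t * Complex.exp (Complex.I * x * t) ∂dq with hM
  have hz1 : ‖z‖ = 1 := by rw [hz, Complex.norm_exp]; simp
  have hw : ‖z / 2‖ < 1 := by rw [norm_div, hz1]; norm_num
  have h2z : 2 - z ≠ 0 := by
    intro h
    rw [← sub_eq_zero.1 h] at hz1
    norm_num at hz1
  rw [(hasDerivAt_fourierStieltjes x).deriv]
  have hexp : ∀ u : ℝ, Complex.exp (-(x / (Complex.I * u))) / (Complex.I * u)
      = -Complex.I * ((u⁻¹ : ℝ) * Complex.exp (Complex.I * x * (u⁻¹ : ℝ))) := by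
    intro u
    rw [← div_div, div_eq_mul_inv (_ / _), div_eq_mul_inv (_ : ℂ) Complex.I, ← div_div,
      div_eq_mul_inv (_ / _) (u : ℂ), div_eq_mul_inv _ Complex.I, Complex.inv_I]
    push_cast
    ring_nf
  simp_rw [hexp]
  have hsum := hasSum_integral_dq
    (g := fun u : ℝ => -Complex.I * ((u⁻¹ : ℝ) * Complex.exp (Complex.I * x * (u⁻¹ : ℝ))))
    (by fun_prop) ?_
  · have hterm : ∀ n : ℕ, (2⁻¹ : ℂ) ^ (n + 1) * ∫ s in Set.Icc (0 : ℝ) 1, -Complex.I *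
        (((((n + 1 : ℕ) + s : ℝ)⁻¹)⁻¹ : ℝ) *
          Complex.exp (Complex.I * x * ((((n + 1 : ℕ) + s : ℝ)⁻¹)⁻¹ : ℝ))) ∂dq
        = -Complex.I * (fourierStieltjes x * ((n + 1 : ℕ) * (z / 2) ^ (n + 1))
          + M * (z / 2) ^ (n + 1)) := by
      intro n
      have e : ∀ s : ℝ, -Complex.I *
        (((((n + 1 : ℕ) + s : ℝ)⁻¹)⁻¹ : ℝ) *
          Complex.exp (Complex.I * x * ((((n + 1 : ℕ) + s : ℝ)⁻¹)⁻¹ : ℝ))) =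
          -Complex.I * z ^ (n + 1) * ((n + 1 : ℕ) * Complex.exp (Complex.I * x * s)
            + s * Complex.exp (Complex.I * x * s)) := by
        intro s
        rw [inv_inv, hz, ← Complex.exp_nat_mul]
        push_cast
        rw [show Complex.I * x * ((n : ℂ) + 1 + s)
          = ((n : ℂ) + 1) * (Complex.I * x) + Complex.I * x * s by ring, Complex.exp_add]
        ring
      simp_rw [e]
      rw [integral_const_mul, integral_add, integral_const_mul, div_pow, inv_pow]
      · rw [fourierStieltjes]
        ring
      · exact Continuous.integrableOn_Icc (by fun_prop)
      · exact Continuous.integrableOn_Icc (by fun_prop)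
    simp_rw [hterm] at hsum
    have h2 : 1 - z / 2 = (2 - z) / 2 := by ring
    refine (hsum.unique
      (hasSum_succ_mul_pow_add_pow hw (fourierStieltjes x) M (-Complex.I))).trans ?_
    rw [h2, ← hM]
    field_simp
    ring
  · refine Integrable.mono' integrableOn_inv_sq
      (Measurable.aestronglyMeasurable (by fun_prop)) ?_
    filter_upwards [ae_mem_Ioc_dq] with t ht
    have h1 : ‖Complex.exp (Complex.I * x * (t⁻¹ : ℝ))‖ = 1 := by
      rw [Complex.norm_exp]; simp
    rw [norm_mul, norm_mul, h1, norm_neg, Complex.norm_I, Complex.norm_real, one_mul, mul_one,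
      Real.norm_of_nonneg (inv_nonneg.2 ht.1.le)]
    refine inv_anti₀ (pow_pos ht.1 2) ?_
    nlinarith [ht.1, ht.2]

end Minkowski

theorem theorem1 (x : ℝ) (hx : 0 < x) :
    DifferentiableAt ℝ Minkowski.fourierStieltjes x ∧
    ∃ H : ℂ,
      Minkowski.HasImproperIntegral
        (fun y : ℝ => (Minkowski.besselJ0 (2 * Real.sqrt (x * y)) : ℂ) *
          Complex.exp (-(Complex.I * y)) * Minkowski.fourierStieltjes y) H ∧
      Complex.exp (Complex.I * x) / (2 - Complex.exp (Complex.I * x)) *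
          (deriv Minkowski.fourierStieltjes x +
            2 * Complex.I * Minkowski.fourierStieltjes x / (2 - Complex.exp (Complex.I * x)))
        = -H := by
  have hcont : Continuous Minkowski.fourierStieltjes := continuous_iff_continuousAt.2 fun y =>
    (Minkowski.hasDerivAt_fourierStieltjes y).continuousAt
  have hJ : ∀ Y : ℝ, 0 ≤ Y → Set.EqOn
      (fun y : ℝ => (Minkowski.besselClifford 0 (x * y) : ℂ) *
        (Complex.exp (-(Complex.I * y)) * Minkowski.fourierStieltjes y))
      (fun y : ℝ => (Minkowski.besselJ0 (2 * Real.sqrt (x * y)) : ℂ) *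
        Complex.exp (-(Complex.I * y)) * Minkowski.fourierStieltjes y) (Set.uIcc 0 Y) := by
    intro Y hY y hy
    rw [Set.uIcc_of_le hY] at hy
    simp only
    rw [Minkowski.besselJ0_two_mul_sqrt (mul_nonneg hx.le hy.1), mul_assoc]
  refine ⟨(Minkowski.hasDerivAt_fourierStieltjes x).differentiableAt, _, ⟨fun Y hY => ?_,
    (Minkowski.tendsto_integral_besselClifford_mul_fourierStieltjes hx).congr' ?_⟩, ?_⟩
  · have := Minkowski.continuous_besselClifford 0
    refine IntervalIntegrable.congr (Set.EqOn.mono Set.uIoc_subset_uIcc (hJ Y hY))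
      (Continuous.intervalIntegrable (by fun_prop) 0 Y)
  · filter_upwards [eventually_ge_atTop 0] with Y hY
    exact intervalIntegral.integral_congr (hJ Y hY)
  · rw [Minkowski.integral_exp_div_dq, neg_neg]
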